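/- Let $d\ge 3$ and $s\ge 1$ be integers, let $\log^{(i)}$ denote the $i$-fold iterated logarithm ($\log^{(0)}t=t$), and let $$\psi_{s,d}(q)=\left(\frac{1}{q\,(\log q)(\log^{(2)}q)\cdots(\log^{(s)}q)}\right)^{1/d},$$ defined for all sufficiently large $q\in\mathbb N$. Let $\mathcal W_d(\psi_{s,d})$ be the set of $\boldsymbol x\in\mathbb R^d$ for which $\|q\boldsymbol x-\boldsymbol p\|_\infty<\psi_{s,d}(q)$ holds for infinitely many $(\boldsymbol p,q)\in\mathbb Z^d\times\mathbb N$. For an irrational number $x=[a_0;a_1,a_2,\dots]$ with continuants (denominators of convergents) $q_0,q_1,\dots$, $q_{-1}=0$, and a real $R\ge 0$, let $k_0=-1$ and let $k_1<k_2<\cdots$, $k_m=k_m^{x,R}$, be the indices $k\ge 0$ with $a_{k+1}>R$; put $\Delta k_m=k_{m+1}-k_m$. For $\sigma\ge 1$, call $x$ essentially $\sigma$-approximable if there are $R\ge 0$ and a set of $m$'s of positive lower asymptotic density on which $q_{k_m}^{\sigma}<q_{k_m+1}$, where $k_m=k_m^{x,R}$; the essential Diophantine type of $x$ is the supremum of all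 $\sigma\in[1,\infty)$ for which $x$ is essentially $\sigma$-approximable. Let $x$ be irrational and not a Liouville number, and let $R\ge 0$. Suppose that, with $k_m=k_m^{x,R}$, at least one of the following holds: (a) for some $\varepsilon>0$, $\dfrac{\log^{(s-1)}\Delta k_m}{\log^{(s-1)}k_m}\ge 1+\varepsilon$ for infinitely many $m$; (b) the essential Diophantine type of $x$ is greater than $1$, and $\Delta k_m\le k_m$ for all sufficiently large $m$. Then for Lebesgue-almost every $\boldsymbol y\in\mathbb R^{d-1}$ the point $(x,\boldsymbol y)$ lies in $\mathcal W_d(\psi_{s,d})$. -/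

import Mathlib

open Filter MeasureTheory

noncomputable section

namespace FiberApprox

/-- The set `W_d(ψ)` of `ψ`-approximable vectors of `ℝ^d`: those `x` for which
`‖q x - p‖_∞ < ψ q` holds for infinitely many `(p, q)` with `p ∈ ℤ^d` and `q ≥ 1`.
The norm on `Fin d → ℝ` is the sup norm. -/
def approximable (d : ℕ) (ψ : ℕ → ℝ) : Set (Fin d → ℝ) :=
  {x | {pq : (Fin d → ℤ) × ℕ |
    0 < pq.2 ∧ ‖(pq.2 : ℝ) • x - (fun i => (pq.1 i : ℝ))‖ < ψ pq.2}.Infinite}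

/-- The `n`-fold iterated logarithm `log ∘ ⋯ ∘ log`; for `n = 0` the identity. -/
def iterLog (n : ℕ) (t : ℝ) : ℝ := Real.log^[n] t

/-- `ψ_{s,d}(q) = (1 / (q · log q · log log q ⋯ log^{(s)} q))^{1/d}`.
For fixed `s` every factor is positive for all but finitely many `q`, and changing a function at
finitely many `q` does not change the set of vectors approximable by it, because for each `q` only
finitely many `p` can occur. -/
def psi (s d : ℕ) (q : ℕ) : ℝ :=
  (1 / ∏ i ∈ Finset.range (s + 1), iterLog i (q : ℝ)) ^ (1 / (d : ℝ))

/-- The indices `j ≥ 0` with `a_{j+1} > R`, where `x = [a_0; a_1, a_2, …]` is the simple continued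
fraction expansion (the `j`-th entry of `partDens` is `a_{j+1}`). -/
def largeIndices (x R : ℝ) : Set ℕ :=
  {j | ∃ a : ℝ, (GenContFract.of x).partDens.get? j = some a ∧ R < a}

/-- The sequence `k_0 = -1 < k_1 < k_2 < ⋯`, where `k_1 < k_2 < ⋯` enumerates the indices `j ≥ 0`
with `a_{j+1} > R`. The values are meaningful for all `m` if there are infinitely many such
indices; otherwise the sequence terminates and later values are filled with `0`. -/
def kSeq (x R : ℝ) : ℕ → ℤ
  | 0 => -1
  | m + 1 => (Nat.nth (fun j => j ∈ largeIndices x R) m : ℕ)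

/-- `Δk_m = k_{m+1} - k_m`. -/
def deltaK (x R : ℝ) (m : ℕ) : ℤ := kSeq x R (m + 1) - kSeq x R m

/-- The continuants `q_k` (denominators of the convergents), with the convention `q_{-1} = 0`. -/
def continuant (x : ℝ) : ℤ → ℝ
  | Int.ofNat n => (GenContFract.of x).dens n
  | Int.negSucc _ => 0

/-- Lower asymptotic density `liminf_N |A ∩ [1, N]| / N`. -/
def lowerDensity (A : Set ℕ) : ℝ :=
  liminf (fun N : ℕ => ((A ∩ Set.Icc 1 N).ncard : ℝ) / (N : ℝ)) atTop

/-- The set of essentially `σ`-approximable numbers: for some `R ≥ 0`, the inequality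
`q_{k_m}^σ < q_{k_m + 1}` holds for all `m` in a set of positive lower asymptotic density
(so in particular the sequence `k_m` does not terminate). -/
def essApproximable (σ : ℝ) : Set ℝ :=
  {x | ∃ R : ℝ, 0 ≤ R ∧ (largeIndices x R).Infinite ∧
    ∃ A : Set ℕ, 0 < lowerDensity A ∧
      ∀ m ∈ A, continuant x (kSeq x R m) ^ σ < continuant x (kSeq x R m + 1)}

/-- The essential Diophantine type: the supremum (possibly infinite) of all `σ ∈ [1, ∞)` such that
`x` is essentially `σ`-approximable. -/
def essDiophantineType (x : ℝ) : EReal :=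
  sSup ((fun σ : ℝ => (σ : EReal)) '' {σ : ℝ | 1 ≤ σ ∧ x ∈ essApproximable σ})

end FiberApprox

end

/-! Write `d = n + 1` with `n ≥ 2`, fix `x`, and let `A` be the set of large `q` with `‖q x‖ <
ψ(q)`, the distance being to the nearest integer. For `q ∈ A` the first coordinate is already
approximated, so it remains to approximate almost every `y ∈ ℝ^n` to within `ψ(q)` using only
denominators `q ∈ A`. This is Khintchine's problem for `ψ · 1_A`, which is not monotone; Gallagher's
theorem (`ae_frequently_norm_sub_lt`) covers it once `∑_{q ∈ A} ψ(q)^n` diverges.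

Divergence is `not_summable_fiberFun_pow`. By pigeonhole, at least `q ψ(q) / 4` elements of `A` lie
below a large `q`. Hence `ψ(q)^(n+1)` is at most `4 ψ(q)^n / q` summed over `a ∈ A`, `a ≤ q`. Since
`ψ^n` decays at least like `q^(-1/2)`, each such term is at most `4 ψ(a)^n √a / q^(3/2)`;
interchanging the sums bounds `∑ ψ^(n+1)` by a constant times `∑_A ψ^n`. For `psi` the former sum is
`∑ 1 / (q log q ⋯ log^{(s)} q) = ∞`.

Gallagher's theorem comes from three facts. Balls about reduced rational vectors are pairwise
quasi-independent, so their limsup has positive measure. Up to a multiplicative constant in the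
radius, the approximable set obeys a zero-one law, by ergodicity of doubling on the torus. The
constant is removed by Cassels' lemma, `blimsup_cthickening_mul_ae_eq`. -/

namespace FiberApprox

/-! ### Counting reduced rational vectors and close pairs of them. -/

open Classical in
/-- Numerators `p ∈ [0, q)^n` of the reduced rational vectors `p / q` in the unit cube. -/
noncomputable def reducedNumerators (n q : ℕ) : Finset (Fin n → ℕ) :=
  (Fintype.piFinset fun _ => Finset.range q).filter
    fun p => ∀ k, k ∣ q → (∀ i, k ∣ p i) → k = 1

lemma mem_reducedNumerators {n q : ℕ} {p : Fin n → ℕ} :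
    p ∈ reducedNumerators n q ↔
      (∀ i, p i < q) ∧ ∀ k, k ∣ q → (∀ i, k ∣ p i) → k = 1 := by
  simp [reducedNumerators]

/-- Telescoping. What matters is that `3 / 4 < 1`, which leaves a positive proportion of reduced
vectors. -/
lemma sum_Icc_inv_sq_le (q : ℕ) (hq : 2 ≤ q) :
    ∑ k ∈ Finset.Icc 2 q, (1 / (k : ℝ) ^ 2) ≤ 3 / 4 - 1 / (q : ℝ) := by
  induction q, hq using Nat.le_induction with
  | base => norm_num
  | succ q hq ih =>
    rw [Finset.sum_Icc_succ_top (by omega)]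
    have hq0 : (0 : ℝ) < q := by positivity
    have : 1 / ((q + 1 : ℕ) : ℝ) ^ 2 ≤ 1 / q - 1 / ((q + 1 : ℕ) : ℝ) := by
      push_cast
      rw [div_sub_div _ _ (by positivity) (by positivity),
        div_le_div_iff₀ (by positivity) (by positivity)]
      nlinarith
    linarith

lemma card_range_filter_dvd_le {q k : ℕ} (hk : k ∣ q) :
    ((Finset.range q).filter (k ∣ ·)).card ≤ q / k := by
  rcases Nat.eq_zero_or_pos k with rfl | hk0
  · simp [Nat.eq_zero_of_zero_dvd hk]
  rw [← Finset.card_range (q / k)]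
  refine Finset.card_le_card_of_injOn (· / k) ?_ ?_
  · intro u hu
    simp only [Finset.coe_filter, Finset.mem_range, Set.mem_ofPred_eq] at hu
    simpa using Nat.div_lt_div_of_lt_of_dvd hk hu.1
  · intro u hu v hv huv
    simp only [Finset.coe_filter, Finset.mem_range, Set.mem_ofPred_eq] at hu hv
    exact (Nat.div_left_inj hu.2 hv.2).1 huv

/-- A non-reduced vector has all coordinates divisible by some divisor `k > 1` of `q`, which leaves
`(q / k)^n ≤ q^n / k^2` choices for each `k`. The exponent `2` is where `n ≥ 2` enters. -/
lemma pow_le_card_reducedNumerators {n : ℕ} (hn : 2 ≤ n) (q : ℕ) :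
    (q : ℝ) ^ n / 4 ≤ (reducedNumerators n q).card := by
  classical
  rcases Nat.eq_zero_or_pos q with rfl | hq
  · simp [show n ≠ 0 by omega]
  set U : Finset (Fin n → ℕ) := Fintype.piFinset fun _ => Finset.range q
  have hsub : U ⊆ reducedNumerators n q ∪ (q.divisors.erase 1).biUnion
      fun k => Fintype.piFinset fun _ => (Finset.range q).filter (k ∣ ·) := by
    intro p hp
    have hp' : ∀ i, p i < q := by simpa [U] using hp
    by_cases h : p ∈ reducedNumerators n q
    · exact Finset.mem_union_left _ h
    · refine Finset.mem_union_right _ ?_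
      rw [mem_reducedNumerators] at h
      push Not at h
      obtain ⟨k, hkq, hkp, hk1⟩ := h hp'
      simp only [Finset.mem_biUnion, Finset.mem_erase, Nat.mem_divisors, Fintype.mem_piFinset,
        Finset.mem_filter, Finset.mem_range]
      exact ⟨k, ⟨hk1, hkq, hq.ne'⟩, fun i => ⟨hp' i, hkp i⟩⟩
  have hcard := (Finset.card_le_card hsub).trans (Finset.card_union_le _ _)
  have hU : U.card = q ^ n := by simp [U]
  have hbi : (((q.divisors.erase 1).biUnion
      fun k => Fintype.piFinset fun _ : Fin n =>
        (Finset.range q).filter (k ∣ ·)).card : ℝ) ≤ (q : ℝ) ^ n * (3 / 4) := by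
    have h1 := Finset.card_biUnion_le (s := q.divisors.erase 1)
      (t := fun k => Fintype.piFinset fun _ : Fin n => (Finset.range q).filter (k ∣ ·))
    refine (Nat.cast_le.2 h1).trans ?_
    push_cast
    have h2 : ∀ k ∈ q.divisors.erase 1, ((Fintype.piFinset fun _ : Fin n =>
        (Finset.range q).filter (k ∣ ·)).card : ℝ) ≤ (q : ℝ) ^ n * (1 / (k : ℝ) ^ 2) := by
      intro k hk
      simp only [Finset.mem_erase, Nat.mem_divisors] at hk
      have hk0 : 0 < k := Nat.pos_of_dvd_of_pos hk.2.1 hq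
      have hk1 : (1 : ℝ) ≤ k := by exact_mod_cast hk0
      rw [Fintype.card_piFinset_const]
      have h3 : (((Finset.range q).filter (k ∣ ·)).card : ℝ) ≤ q / k :=
        (Nat.cast_le.2 (card_range_filter_dvd_le hk.2.1)).trans Nat.cast_div_le
      push_cast
      calc _ ≤ ((q : ℝ) / k) ^ n := by gcongr
        _ = (q : ℝ) ^ n * (1 / (k : ℝ) ^ n) := by rw [div_pow]; ring
        _ ≤ _ := by gcongr
    refine (Finset.sum_le_sum h2).trans ?_
    rw [← Finset.mul_sum]
    gcongr
    have hsub2 : q.divisors.erase 1 ⊆ Finset.Icc 2 q := by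
      intro k hk
      simp only [Finset.mem_erase, Nat.mem_divisors] at hk
      have := Nat.pos_of_dvd_of_pos hk.2.1 hq
      have := Nat.le_of_dvd hq hk.2.1
      simp only [Finset.mem_Icc]
      omega
    refine (Finset.sum_le_sum_of_subset_of_nonneg hsub2 fun _ _ _ => by positivity).trans ?_
    rcases le_or_gt 2 q with h | h
    · have := sum_Icc_inv_sq_le q h
      have : (0 : ℝ) ≤ 1 / q := by positivity
      linarith
    · rw [Finset.Icc_eq_empty (by omega)]
      norm_num
  rw [hU] at hcard
  have := (Nat.cast_le (α := ℝ)).2 hcard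
  push_cast at this hbi
  linarith

/-- Reduced rational vectors with different denominators are different. -/
lemma eq_of_mul_eq_mul {n q q' : ℕ} {p p' : Fin n → ℕ} (hp : p ∈ reducedNumerators n q)
    (hp' : p' ∈ reducedNumerators n q') (hq : 0 < q)
    (h : ∀ i, p i * q' = p' i * q) : q = q' := by
  rw [mem_reducedNumerators] at hp hp'
  obtain ⟨g, a, b, hg, hab, rfl, rfl⟩ := Nat.exists_coprime' (m := q) (n := q')
    (Nat.gcd_pos_of_pos_left _ hq)
  have h' : ∀ i, p i * b = p' i * a := fun i => by
    have := h i
    rw [← mul_assoc, ← mul_assoc] at this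
    exact Nat.eq_of_mul_eq_mul_right hg this
  have ha : a = 1 := hp.2 a (Dvd.intro _ rfl) fun i =>
    hab.dvd_of_dvd_mul_right ((h' i).symm ▸ Dvd.intro_left _ rfl)
  have hb : b = 1 := hp'.2 b (Dvd.intro _ rfl) fun i =>
    hab.symm.dvd_of_dvd_mul_right ((h' i) ▸ Dvd.intro_left _ rfl)
  rw [ha, hb]

open Classical in
/-- Pairs `(u, v)` with `u / q` and `v / q'` in `[0, 1)` at distance less than `Δ / (q q')`. -/
noncomputable def closePairs (q q' : ℕ) (Δ : ℝ) : Finset (ℕ × ℕ) :=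
  (Finset.range q ×ˢ Finset.range q').filter fun w => |(w.1 : ℝ) * q' - w.2 * q| < Δ

/-- With `q = g a`, `q' = g b` and `a`, `b` coprime, the quantity `u q' - v q` is `g (u b - v a)`.
The integer `u b - v a` determines `u` mod `a`, so together with `u / a < g` it determines `(u, v)`.
-/
lemma card_closePairs_le {q q' : ℕ} (hq : 0 < q) {Δ : ℝ}
    (hΔ : (q.gcd q' : ℝ) ≤ Δ) : ((closePairs q q' Δ).card : ℝ) ≤ 3 * Δ := by
  classical
  obtain ⟨g, a, b, hg, hab, hqa, hqb⟩ := Nat.exists_coprime' (m := q) (n := q')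
    (Nat.gcd_pos_of_pos_left _ hq)
  have hgcd : q.gcd q' = g := by
    rw [hqa, hqb, Nat.gcd_mul_right, hab.gcd_eq_one, one_mul]
  rw [hgcd] at hΔ
  have hg' : (0 : ℝ) < g := by exact_mod_cast hg
  have ha : 0 < a := Nat.pos_of_mul_pos_right (hqa ▸ hq)
  set T := ⌊Δ / g⌋ with hT
  -- This makes `2 T + 1 ≤ 3 T`; it fails without the gcd hypothesis, as `g` pairs have difference
  -- zero.
  have hT1 : 1 ≤ T := by rw [hT, Int.le_floor]; push_cast; rwa [one_le_div hg']
  have hcard : (closePairs q q' Δ).card ≤ (Finset.Icc (-T) T ×ˢ Finset.range g).card := by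
    refine Finset.card_le_card_of_injOn
      (fun w => ((w.1 : ℤ) * b - w.2 * a, w.1 / a)) ?_ ?_
    · rintro ⟨u, v⟩ hw
      simp only [closePairs, Finset.coe_filter, Finset.mem_product, Finset.mem_range,
        Set.mem_ofPred_eq] at hw
      simp only [Finset.coe_product, Finset.coe_Icc, Finset.coe_range, Set.mem_prod, Set.mem_Icc,
        Set.mem_Iio]
      refine ⟨?_, ?_⟩
      · rw [← abs_le, hT, Int.le_floor, le_div_iff₀ hg']
        push_cast
        have := hw.2.le
        rw [hqa, hqb] at this
        push_cast at this
        calc _ = |((u : ℝ) * b - v * a) * g| := by rw [abs_mul, abs_of_pos hg']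
          _ = |(u : ℝ) * (b * g) - v * (a * g)| := by congr 1; ring
          _ ≤ Δ := this
      · rw [Nat.div_lt_iff_lt_mul ha, mul_comm, ← hqa]
        exact hw.1.1
    · rintro ⟨u, v⟩ _ ⟨u', v'⟩ _ h
      simp only [Prod.mk.injEq] at h ⊢
      obtain ⟨h1, h2⟩ := h
      have hmod : u ≡ u' [MOD a] := by
        have h3 : ((a : ℕ) : ℤ) ∣ ((u' : ℤ) - u) * b := ⟨v' - v, by linarith⟩
        have h4 : IsCoprime (a : ℤ) (b : ℤ) := Nat.isCoprime_iff_coprime.2 hab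
        exact (Nat.modEq_iff_dvd).2 (h4.dvd_of_dvd_mul_right h3)
      have hu : u = u' := by
        rw [← Nat.div_add_mod u a, ← Nat.div_add_mod u' a, h2, hmod]
      subst hu
      refine ⟨rfl, ?_⟩
      have : (v : ℤ) * a = v' * a := by linarith
      exact_mod_cast mul_right_cancel₀ (by exact_mod_cast ha.ne') this
  have hcard' : (Finset.Icc (-T) T ×ˢ Finset.range g).card = ((2 * T + 1).toNat) * g := by
    rw [Finset.card_product, Int.card_Icc, Finset.card_range]
    congr 2
    ring
  rw [hcard'] at hcard
  have hT3 : ((2 * T + 1).toNat : ℝ) ≤ 3 * (Δ / g) := by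
    have e : (((2 * T + 1).toNat : ℤ) : ℝ) = 2 * T + 1 := by
      rw [Int.toNat_of_nonneg (by omega)]; push_cast; ring
    have h1 : (T : ℝ) ≤ Δ / g := Int.floor_le _
    have h2 : (1 : ℝ) ≤ T := by exact_mod_cast hT1
    rw [Int.cast_natCast] at e
    rw [e]
    linarith
  calc ((closePairs q q' Δ).card : ℝ) ≤ ((2 * T + 1).toNat : ℝ) * g := by exact_mod_cast hcard
    _ ≤ 3 * (Δ / g) * g := by gcongr
    _ = 3 * Δ := by field_simp

open Classical in
/-- Pairs of reduced rational vectors `p / q`, `p' / q'` at sup-distance less than `Δ / (q q')`. -/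
noncomputable def closeReducedPairs (n q q' : ℕ) (Δ : ℝ) : Finset ((Fin n → ℕ) × (Fin n → ℕ)) :=
  (reducedNumerators n q ×ˢ reducedNumerators n q').filter
    fun w => ∀ i, |(w.1 i : ℝ) * q' - w.2 i * q| < Δ

/-- Reducedness removes the gcd condition of `card_closePairs_le`: if `Δ < gcd(q, q')`, the
differences are multiples of the gcd smaller than it, so all vanish and `q = q'`. Otherwise the
count is made coordinate by coordinate. -/
lemma card_closeReducedPairs_le {n q q' : ℕ} (hq : 0 < q) (hne : q ≠ q') {Δ : ℝ} (hΔ : 0 ≤ Δ) :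
    ((closeReducedPairs n q q' Δ).card : ℝ) ≤ (3 * Δ) ^ n := by
  classical
  rcases (closeReducedPairs n q q' Δ).eq_empty_or_nonempty with h | ⟨⟨p, p'⟩, hpp⟩
  · rw [h]; simp only [Finset.card_empty, Nat.cast_zero]; positivity
  have hgΔ : (q.gcd q' : ℝ) ≤ Δ := by
    simp only [closeReducedPairs, Finset.mem_filter, Finset.mem_product] at hpp
    obtain ⟨⟨hp, hp'⟩, hlt⟩ := hpp
    by_contra! hcon
    refine hne (eq_of_mul_eq_mul hp hp' hq fun i => ?_)
    have h1 : ((q.gcd q' : ℕ) : ℤ) ∣ (p i : ℤ) * q' - p' i * q :=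
      dvd_sub (Dvd.dvd.mul_left (by exact_mod_cast Nat.gcd_dvd_right _ _) _)
        (Dvd.dvd.mul_left (by exact_mod_cast Nat.gcd_dvd_left _ _) _)
    have h2 : |(p i : ℤ) * q' - p' i * q| < (q.gcd q' : ℕ) := by
      have := (hlt i).trans hcon
      exact_mod_cast this
    have := Int.eq_zero_of_abs_lt_dvd h1 h2
    exact_mod_cast sub_eq_zero.1 this
  have hinj : (closeReducedPairs n q q' Δ).card ≤
      (Fintype.piFinset fun _ : Fin n => closePairs q q' Δ).card := by
    refine Finset.card_le_card_of_injOn (fun w i => (w.1 i, w.2 i)) ?_ ?_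
    · rintro ⟨u, v⟩ hw
      simp only [closeReducedPairs, Finset.coe_filter, Finset.mem_product, Set.mem_ofPred_eq,
        mem_reducedNumerators] at hw
      simp only [Finset.mem_coe, Fintype.mem_piFinset, closePairs, Finset.mem_filter,
        Finset.mem_product, Finset.mem_range]
      exact fun i => ⟨⟨hw.1.1.1 i, hw.1.2.1 i⟩, hw.2 i⟩
    · rintro ⟨u, v⟩ _ ⟨u', v'⟩ _ h
      have h' := fun i => congrFun h i
      simp only [Prod.mk.injEq] at h' ⊢
      exact ⟨funext fun i => (h' i).1, funext fun i => (h' i).2⟩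
  rw [Fintype.card_piFinset_const] at hinj
  calc ((closeReducedPairs n q q' Δ).card : ℝ) ≤ ((closePairs q q' Δ).card : ℝ) ^ n := by
        exact_mod_cast hinj
    _ ≤ _ := by gcongr; exact card_closePairs_le hq hgΔ

/-! ### Divergence Borel–Cantelli by second moments. -/

section BorelCantelli

variable {α : Type*} [MeasurableSpace α] {μ : Measure α} [IsFiniteMeasure μ] {E : ℕ → Set α}

/-- Second-moment argument: with `X = ∑ 1_{E i}`, integrate `(X - t 1_U)^2 ≥ 0`. Here `X` vanishes
off `U`, and `∫ X^2 ≤ C a^2 + a ≤ (C + 1) a^2` because `a ≥ 1`; the choice `t = (C + 1) a` gives the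
bound. -/
lemma inv_le_measureReal_biUnion (hE : ∀ i, MeasurableSet (E i)) {C : ℝ} (hC : 0 ≤ C)
    (hind : ∀ i j, i ≠ j → μ.real (E i ∩ E j) ≤ C * (μ.real (E i) * μ.real (E j)))
    (S : Finset ℕ) (hS : 1 ≤ ∑ i ∈ S, μ.real (E i)) :
    1 / (C + 1) ≤ μ.real (⋃ i ∈ S, E i) := by
  classical
  set a := ∑ i ∈ S, μ.real (E i) with ha
  set U := ⋃ i ∈ S, E i with hU
  have hUm : MeasurableSet U := Finset.measurableSet_biUnion _ fun i _ => hE i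
  set t := (C + 1) * a
  let ind : Set α → α → ℝ := fun s => s.indicator 1
  have hint : ∀ s, MeasurableSet s → Integrable (ind s) μ := fun s hs =>
    (integrable_const (1 : ℝ)).indicator hs
  have hval : ∀ s, MeasurableSet s → ∫ y, ind s y ∂μ = μ.real s := fun s hs =>
    integral_indicator_one hs
  have hprod : ∀ s s' y, ind s y * ind s' y = ind (s ∩ s') y := fun s s' y => by
    simp only [ind, Set.inter_indicator_one, Pi.mul_apply]
  have hpt : ∀ y, 0 ≤ (∑ i ∈ S, ∑ j ∈ S, ind (E i ∩ E j) y) - 2 * t * (∑ i ∈ S, ind (E i) y)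
      + t ^ 2 * ind U y := by
    intro y
    have h1 : (∑ i ∈ S, ∑ j ∈ S, ind (E i ∩ E j) y) =
        (∑ i ∈ S, ind (E i) y) * ∑ i ∈ S, ind (E i) y := by
      rw [Finset.sum_mul_sum]
      simp only [hprod]
    rw [h1]
    by_cases hy : y ∈ U
    · have : ind U y = 1 := by simp [ind, hy]
      rw [this]
      nlinarith [sq_nonneg ((∑ i ∈ S, ind (E i) y) - t)]
    · have h2 : ind U y = 0 := by simp [ind, hy]
      have h3 : ∑ i ∈ S, ind (E i) y = 0 := by
        refine Finset.sum_eq_zero fun i hi => ?_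
        have : y ∉ E i := fun h => hy (Set.mem_biUnion hi h)
        simp [ind, this]
      rw [h2, h3]
      simp
  have hi1 : Integrable (fun y => ∑ i ∈ S, ∑ j ∈ S, ind (E i ∩ E j) y) μ :=
    integrable_finsetSum _ fun i _ => integrable_finsetSum _ fun j _ =>
      hint _ ((hE i).inter (hE j))
  have hi2 : Integrable (fun y => ∑ i ∈ S, ind (E i) y) μ :=
    integrable_finsetSum _ fun i _ => hint _ (hE i)
  have hi12 : Integrable (fun y => (∑ i ∈ S, ∑ j ∈ S, ind (E i ∩ E j) y)
      - 2 * t * (∑ i ∈ S, ind (E i) y)) μ := hi1.sub (hi2.const_mul _)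
  have hcalc : ∫ y, ((∑ i ∈ S, ∑ j ∈ S, ind (E i ∩ E j) y) - 2 * t * (∑ i ∈ S, ind (E i) y)
      + t ^ 2 * ind U y) ∂μ =
      (∑ i ∈ S, ∑ j ∈ S, μ.real (E i ∩ E j)) - 2 * t * a + t ^ 2 * μ.real U := by
    rw [integral_add hi12 ((hint _ hUm).const_mul _),
      integral_sub hi1 (hi2.const_mul _), integral_const_mul, integral_const_mul, hval _ hUm,
      integral_finsetSum _ fun i _ => hint _ (hE i),
      integral_finsetSum _ fun i _ => integrable_finsetSum _ fun j _ =>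
        hint _ ((hE i).inter (hE j))]
    congr 2
    · refine Finset.sum_congr rfl fun i _ => ?_
      rw [integral_finsetSum _ fun j _ => hint _ ((hE i).inter (hE j))]
      exact Finset.sum_congr rfl fun j _ => hval _ ((hE i).inter (hE j))
    · rw [ha]
      congr 1
      exact Finset.sum_congr rfl fun j _ => hval _ (hE j)
  have hsq : (∑ i ∈ S, ∑ j ∈ S, μ.real (E i ∩ E j)) ≤ C * a ^ 2 + a := by
    have : ∀ i ∈ S, ∑ j ∈ S, μ.real (E i ∩ E j) ≤ C * (μ.real (E i) * a) + μ.real (E i) := by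
      intro i hi
      rw [← Finset.add_sum_erase _ _ hi, Set.inter_self, add_comm]
      gcongr
      calc _ ≤ ∑ j ∈ S.erase i, C * (μ.real (E i) * μ.real (E j)) :=
            Finset.sum_le_sum fun j hj => hind i j (Finset.ne_of_mem_erase hj).symm
        _ ≤ ∑ j ∈ S, C * (μ.real (E i) * μ.real (E j)) :=
            Finset.sum_le_sum_of_subset_of_nonneg (Finset.erase_subset _ _)
              fun _ _ _ => by positivity
        _ = _ := by rw [← Finset.mul_sum, ← Finset.mul_sum]
    refine (Finset.sum_le_sum this).trans_eq ?_
    rw [Finset.sum_add_distrib, ← Finset.mul_sum, ← Finset.sum_mul]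
    ring
  have hI : 0 ≤ (∑ i ∈ S, ∑ j ∈ S, μ.real (E i ∩ E j)) - 2 * t * a + t ^ 2 * μ.real U := by
    rw [← hcalc]
    exact integral_nonneg hpt
  rw [div_le_iff₀ (by positivity)]
  have h4 : 0 ≤ ((C + 1) * a ^ 2) * (μ.real U * (C + 1) - 1) := by
    have : (C * a ^ 2 + a) ≤ (C + 1) * a ^ 2 := by nlinarith
    calc (0 : ℝ) ≤ (C + 1) * a ^ 2 - 2 * t * a + t ^ 2 * μ.real U := by linarith
      _ = _ := by simp only [t]; ring
  have := nonneg_of_mul_nonneg_right h4 (by positivity)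
  linarith

/-- The divergence Borel–Cantelli lemma for pairwise quasi-independent sets. -/
lemma measure_limsup_pos_of_quasiIndep (hE : ∀ i, MeasurableSet (E i)) {C : ℝ} (hC : 0 ≤ C)
    (hind : ∀ i j, i ≠ j → μ.real (E i ∩ E j) ≤ C * (μ.real (E i) * μ.real (E j)))
    (hdiv : ¬ Summable fun i => μ.real (E i)) : 0 < μ (limsup E atTop) := by
  -- Each tail still diverges, so it has a finite block of total measure at least `1`; continuity
  -- from above then passes the uniform bound to the limsup.
  have key : ∀ N, ENNReal.ofReal (1 / (C + 1)) ≤ μ (⋃ i ≥ N, E i) := by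
    intro N
    have hdiv' : ¬ Summable fun i => μ.real (E (i + N)) := by
      rwa [summable_nat_add_iff (f := fun i => μ.real (E i)) N]
    have htend := (not_summable_iff_tendsto_nat_atTop_of_nonneg
      (fun _ => measureReal_nonneg)).1 hdiv'
    obtain ⟨M, hM⟩ := (htend.eventually_ge_atTop 1).exists
    have h := inv_le_measureReal_biUnion (μ := μ) (E := fun i => E (i + N)) (fun i => hE _) hC
      (fun i j hij => hind _ _ (by omega)) (Finset.range M) hM
    refine (ENNReal.ofReal_le_of_le_toReal h).trans (measure_mono ?_)
    simp only [Set.iUnion_subset_iff]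
    exact fun i _ => Set.subset_biUnion_of_mem (u := E) (show i + N ≥ N by omega)
  have hpos : 0 < ENNReal.ofReal (1 / (C + 1)) := by rw [ENNReal.ofReal_pos]; positivity
  refine hpos.trans_le ?_
  rw [limsup_eq_iInf_iSup_of_nat]
  simp only [Set.iSup_eq_iUnion, Set.iInf_eq_iInter]
  refine ge_of_tendsto (tendsto_measure_iInter_atTop (μ := μ) (s := fun N => ⋃ i ≥ N, E i)
    (fun N => (MeasurableSet.iUnion fun i => MeasurableSet.iUnion fun _ =>
      hE i).nullMeasurableSet) ?_ ⟨0, measure_ne_top _ _⟩) (Eventually.of_forall key)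
  intro N N' h
  simp only [Set.iUnion_subset_iff]
  exact fun i hi => Set.subset_biUnion_of_mem (u := E) (show i ≥ N from h.trans hi)

end BorelCantelli

/-! ### Measures and overlaps of the balls about reduced vectors. -/

/-- The balls of radius `ρ / q` about the reduced vectors with denominator `q` in `[0, 1)^n`. -/
def reducedBalls (n q : ℕ) (ρ : ℝ) : Set (Fin n → ℝ) :=
  ⋃ p ∈ reducedNumerators n q, Metric.ball (fun i => (p i : ℝ) / q) (ρ / q)

lemma measurableSet_reducedBalls (n q : ℕ) (ρ : ℝ) : MeasurableSet (reducedBalls n q ρ) :=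
  Finset.measurableSet_biUnion _ fun _ _ => Metric.isOpen_ball.measurableSet

lemma reducedBalls_zero_right (n q : ℕ) : reducedBalls n q 0 = ∅ := by
  simp [reducedBalls]

lemma reducedBalls_zero_left (n : ℕ) (ρ : ℝ) : reducedBalls n 0 ρ = ∅ := by
  simp [reducedBalls]

lemma reducedBalls_subset (n q : ℕ) {ρ : ℝ} (hρ : ρ ≤ 1 / 2) :
    reducedBalls n q ρ ⊆ Metric.ball 0 2 := by
  rcases Nat.eq_zero_or_pos q with rfl | hq
  · simp [reducedBalls_zero_left]
  have hq' : (1 : ℝ) ≤ q := by exact_mod_cast hq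
  simp only [reducedBalls, Set.iUnion_subset_iff]
  intro p hp
  refine Metric.ball_subset_ball' ?_
  have h1 : ρ / q ≤ 1 / 2 := by
    rw [div_le_iff₀ (by positivity)]; linarith
  have h2 : dist (fun i => (p i : ℝ) / q) (0 : Fin n → ℝ) ≤ 1 := by
    refine (dist_pi_le_iff zero_le_one).2 fun i => ?_
    have := ((mem_reducedNumerators.1 hp).1 i).le
    rw [Pi.zero_apply, Real.dist_0_eq_abs, abs_of_nonneg (by positivity), div_le_one (by positivity)]
    exact_mod_cast this
  linarith

lemma volumeReal_ball_pi {n : ℕ} (c : Fin n → ℝ) {ρ : ℝ} (hρ : 0 < ρ) :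
    volume.real (Metric.ball c ρ) = (2 * ρ) ^ n := by
  rw [Measure.real, Real.volume_pi_ball _ hρ, Fintype.card_fin, ENNReal.toReal_ofReal (by positivity)]

lemma le_volumeReal_reducedBalls {n : ℕ} (hn : 2 ≤ n) {q : ℕ} (hq : 0 < q) {ρ : ℝ} (hρ : 0 ≤ ρ)
    (hρ' : ρ ≤ 1 / 2) : (2 * ρ) ^ n / 4 ≤ volume.real (reducedBalls n q ρ) := by
  rcases hρ.eq_or_lt with rfl | hρ0
  · simp [reducedBalls_zero_right, show n ≠ 0 by omega]
  have hq' : (0 : ℝ) < q := by exact_mod_cast hq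
  -- Distinct centres are at least `1 / q ≥ 2 ρ / q` apart.
  have hdisj : (reducedNumerators n q : Set (Fin n → ℕ)).PairwiseDisjoint
      fun p => Metric.ball (fun i => (p i : ℝ) / q) (ρ / q) := by
    intro p _ p' _ hne
    refine Metric.ball_disjoint_ball ?_
    obtain ⟨i, hi⟩ := Function.ne_iff.1 hne
    refine le_trans ?_ (dist_le_pi_dist _ _ i)
    rw [Real.dist_eq, ← sub_div, abs_div, abs_of_pos hq', ← add_div]
    gcongr
    have : (1 : ℤ) ≤ |(p i : ℤ) - p' i| := Int.one_le_abs (by omega)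
    have : (1 : ℝ) ≤ |(p i : ℝ) - p' i| := by exact_mod_cast this
    linarith
  rw [reducedBalls, measureReal_biUnion_finset hdisj
    (fun _ _ => Metric.isOpen_ball.measurableSet) (fun _ _ => measure_ball_lt_top.ne)]
  simp only [volumeReal_ball_pi _ (div_pos hρ0 hq'), Finset.sum_const, nsmul_eq_mul]
  calc (2 * ρ) ^ n / 4 = (q : ℝ) ^ n / 4 * (2 * (ρ / q)) ^ n := by
        rw [div_mul_eq_mul_div, ← mul_pow]
        congr 2
        field_simp
    _ ≤ _ := by gcongr; exact pow_le_card_reducedNumerators hn q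

/-- Intersecting balls have centres within `Δ / (q q')`, so at most `(3 Δ)^n` pairs meet, each in
volume at most `(2 m)^n` with `m` the smaller radius. Finally `q m ≤ ρ` and `q' m ≤ ρ'` give `Δ m ≤
2 ρ ρ'`. -/
lemma volumeReal_reducedBalls_inter_le {n q q' : ℕ} (hq : 0 < q) (hq' : 0 < q') (hne : q ≠ q')
    {ρ ρ' : ℝ} (hρ : 0 < ρ) (hρ' : 0 < ρ') :
    volume.real (reducedBalls n q ρ ∩ reducedBalls n q' ρ') ≤ (12 * (ρ * ρ')) ^ n := by
  have hq0 : (0 : ℝ) < q := by exact_mod_cast hq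
  have hq0' : (0 : ℝ) < q' := by exact_mod_cast hq'
  set Δ := ρ * q' + ρ' * q with hΔ
  set m := min (ρ / q) (ρ' / q') with hm
  have hm0 : 0 < m := lt_min (by positivity) (by positivity)
  have hsub : reducedBalls n q ρ ∩ reducedBalls n q' ρ' ⊆
      ⋃ w ∈ closeReducedPairs n q q' Δ, Metric.ball (fun i => (w.1 i : ℝ) / q) (ρ / q) ∩
        Metric.ball (fun i => (w.2 i : ℝ) / q') (ρ' / q') := by
    rintro y ⟨hy, hy'⟩
    simp only [reducedBalls, Set.mem_iUnion] at hy hy'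
    obtain ⟨p, hp, hyp⟩ := hy
    obtain ⟨p', hp', hyp'⟩ := hy'
    simp only [Set.mem_iUnion]
    refine ⟨(p, p'), ?_, hyp, hyp'⟩
    simp only [closeReducedPairs, Finset.mem_filter, Finset.mem_product]
    refine ⟨⟨hp, hp'⟩, fun i => ?_⟩
    have h1 := (dist_le_pi_dist _ _ i).trans_lt (Metric.mem_ball.1 hyp)
    have h2 := (dist_le_pi_dist _ _ i).trans_lt (Metric.mem_ball.1 hyp')
    have h3 := (dist_triangle_left ((p i : ℝ) / q) ((p' i : ℝ) / q') (y i)).trans_lt (add_lt_add h1 h2)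
    rw [Real.dist_eq] at h3
    have h4 : (p i : ℝ) * q' - p' i * q = ((p i : ℝ) / q - p' i / q') * (q * q') := by
      field_simp
    rw [h4, abs_mul, abs_of_pos (mul_pos hq0 hq0')]
    calc _ < (ρ / q + ρ' / q') * (q * q') := by gcongr
      _ = Δ := by rw [hΔ]; field_simp
  calc volume.real (reducedBalls n q ρ ∩ reducedBalls n q' ρ')
      ≤ volume.real (⋃ w ∈ closeReducedPairs n q q' Δ,
        Metric.ball (fun i => (w.1 i : ℝ) / q) (ρ / q) ∩
        Metric.ball (fun i => (w.2 i : ℝ) / q') (ρ' / q')) := by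
          refine measureReal_mono hsub (ne_top_of_le_ne_top ?_ (measure_biUnion_finset_le _ _))
          refine (ENNReal.sum_lt_top.2 fun w _ => ?_).ne
          exact (measure_mono Set.inter_subset_left).trans_lt measure_ball_lt_top
    _ ≤ ∑ w ∈ closeReducedPairs n q q' Δ,
        volume.real (Metric.ball (fun i => (w.1 i : ℝ) / q) (ρ / q) ∩
        Metric.ball (fun i => (w.2 i : ℝ) / q') (ρ' / q')) := measureReal_biUnion_finset_le _ _
    _ ≤ ∑ w ∈ closeReducedPairs n q q' Δ, (2 * m) ^ n := by
          refine Finset.sum_le_sum fun w _ => ?_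
          rcases min_choice (ρ / q) (ρ' / q') with h | h
          · rw [hm, h, ← volumeReal_ball_pi (fun i => (w.1 i : ℝ) / q) (by positivity)]
            exact measureReal_mono Set.inter_subset_left measure_ball_lt_top.ne
          · rw [hm, h, ← volumeReal_ball_pi (fun i => (w.2 i : ℝ) / q') (by positivity)]
            exact measureReal_mono Set.inter_subset_right measure_ball_lt_top.ne
    _ ≤ (3 * Δ) ^ n * (2 * m) ^ n := by
          rw [Finset.sum_const, nsmul_eq_mul]
          gcongr
          exact card_closeReducedPairs_le hq hne (by positivity)
    _ ≤ _ := by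
          rw [← mul_pow]
          refine pow_le_pow_left₀ (by positivity) ?_ n
          have h1 : q' * m ≤ ρ' := by
            rw [← le_div_iff₀' hq0']; exact min_le_right _ _
          have h2 : q * m ≤ ρ := by
            rw [← le_div_iff₀' hq0]; exact min_le_left _ _
          rw [hΔ]
          nlinarith

/-- Infinitely many reduced rational approximations hold on a set of positive measure. -/
lemma volume_limsup_reducedBalls_pos {n : ℕ} (hn : 2 ≤ n) {r : ℕ → ℝ} (h0 : r 0 = 0)
    (hr : ∀ q, 0 ≤ r q) (hr' : ∀ q, r q ≤ 1 / 2) (hdiv : ¬ Summable fun q => r q ^ n) :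
    0 < volume (limsup (fun q => reducedBalls n q (r q)) atTop) := by
  set μ : Measure (Fin n → ℝ) := volume.restrict (Metric.ball 0 2)
  have : IsFiniteMeasure μ := ⟨by
    rw [Measure.restrict_apply_univ]; exact measure_ball_lt_top⟩
  have hμ : ∀ q, μ.real (reducedBalls n q (r q)) = volume.real (reducedBalls n q (r q)) :=
    fun q => by
      rw [Measure.real, Measure.restrict_eq_self _ (reducedBalls_subset n q (hr' q)), Measure.real]
  have hlow : ∀ q, (2 * r q) ^ n / 4 ≤ μ.real (reducedBalls n q (r q)) := by
    intro q
    rcases Nat.eq_zero_or_pos q with rfl | hq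
    · simp [h0, show n ≠ 0 by omega]
    rw [hμ]
    exact le_volumeReal_reducedBalls hn hq (hr q) (hr' q)
  have hpos : 0 < μ (limsup (fun q => reducedBalls n q (r q)) atTop) := by
    -- The factor `3 ^ n` comes from `12 r r' = 3 (2 r) (2 r')`, and `16` from the two densities `1
    -- / 4` in the lower bound `hlow`.
    refine measure_limsup_pos_of_quasiIndep (C := 16 * 3 ^ n)
      (fun q => measurableSet_reducedBalls _ _ _) (by positivity) (fun q q' hne => ?_) ?_
    · rcases Nat.eq_zero_or_pos q with rfl | hq
      · simp [reducedBalls_zero_left]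
      rcases Nat.eq_zero_or_pos q' with rfl | hq'
      · simp [reducedBalls_zero_left]
      rcases (hr q).eq_or_lt with h | h
      · simp [← h, reducedBalls_zero_right]
      rcases (hr q').eq_or_lt with h' | h'
      · simp [← h', reducedBalls_zero_right]
      calc _ ≤ volume.real (reducedBalls n q (r q) ∩ reducedBalls n q' (r q')) := by
            rw [Measure.real, Measure.restrict_eq_self _
              (Set.inter_subset_left.trans (reducedBalls_subset n q (hr' q))), Measure.real]
        _ ≤ (12 * (r q * r q')) ^ n := volumeReal_reducedBalls_inter_le hq hq' hne h h'
        _ = 16 * 3 ^ n * ((2 * r q) ^ n / 4 * ((2 * r q') ^ n / 4)) := by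
            rw [show 12 * (r q * r q') = 3 * ((2 * r q) * (2 * r q')) by ring, mul_pow, mul_pow]
            ring
        _ ≤ _ := by
            have := hlow q
            have := hlow q'
            have := hr q
            have := hr q'
            gcongr
    · intro hsum
      refine hdiv ?_
      have h1 : Summable fun q => (2 * r q) ^ n / 4 :=
        Summable.of_nonneg_of_le (fun q => by have := hr q; positivity) hlow hsum
      refine (h1.mul_left (4 / 2 ^ n)).congr fun q => ?_
      rw [mul_pow]
      field_simp
  exact hpos.trans_le (Measure.restrict_apply_le _ _)

/-! ### Passage to the torus and the zero-one law. -/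

section Torus

variable {n : ℕ}

/-- The projection of `ℝ^n` onto the torus. -/
def toTorus (y : Fin n → ℝ) : Fin n → UnitAddCircle := fun i => (y i : UnitAddCircle)

/-- Countably many unit cubes cover `ℝ^n`, and the projection preserves measure on each. -/
lemma ae_toTorus {P : (Fin n → UnitAddCircle) → Prop} (h : ∀ᵐ z, P z) :
    ∀ᵐ y : Fin n → ℝ, P (toTorus y) := by
  have hU : (⋃ a : Fin n → ℤ, Set.univ.pi fun i => Set.Ioc ((a i : ℝ) - 1) (a i - 1 + 1)) =
      Set.univ := by
    refine Set.eq_univ_of_forall fun y => Set.mem_iUnion.2 ⟨fun i => ⌈y i⌉, fun i _ => ⟨?_, ?_⟩⟩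
    · linarith [Int.ceil_lt_add_one (y i)]
    · simpa using Int.le_ceil (y i)
  rw [← Measure.restrict_univ (μ := (volume : Measure (Fin n → ℝ))), ← hU,
    ae_restrict_iUnion_iff]
  intro a
  have hmp : MeasurePreserving (toTorus (n := n))
      (volume.restrict (Set.univ.pi fun i => Set.Ioc ((a i : ℝ) - 1) (a i - 1 + 1))) volume := by
    rw [volume_pi, Measure.restrict_pi_pi]
    exact measurePreserving_pi _ _ fun i => UnitAddCircle.measurePreserving_mk (a i - 1)
  exact hmp.quasiMeasurePreserving.ae h

lemma norm_toTorus_lt_iff {y : Fin n → ℝ} {δ : ℝ} (hδ : 0 < δ) :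
    ‖toTorus y‖ < δ ↔ ∃ p : Fin n → ℤ, ‖y - fun i => (p i : ℝ)‖ < δ := by
  constructor
  · intro h
    refine ⟨fun i => round (y i), (pi_norm_lt_iff hδ).2 fun i => ?_⟩
    have := (pi_norm_lt_iff hδ).1 h i
    rwa [toTorus, UnitAddCircle.norm_eq] at this
  · rintro ⟨p, hp⟩
    refine (pi_norm_lt_iff hδ).2 fun i => ?_
    rw [toTorus, UnitAddCircle.norm_eq]
    exact (round_le (y i) (p i)).trans_lt ((pi_norm_lt_iff hδ).1 hp i)

lemma toTorus_nsmul (q : ℕ) (y : Fin n → ℝ) : toTorus ((q : ℝ) • y) = q • toTorus y := by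
  funext i
  change (((q : ℝ) * y i : ℝ) : UnitAddCircle) = q • (y i : UnitAddCircle)
  rw [← AddCircle.coe_nsmul, nsmul_eq_mul]

/-- Doubling is a continuous surjective endomorphism, and the dyadic points, which it eventually
sends to zero, are dense. -/
lemma ergodic_two_nsmul_torus :
    Ergodic (nsmulAddMonoidHom 2 : (Fin n → UnitAddCircle) →+ (Fin n → UnitAddCircle)) volume := by
  refine AddMonoidHom.ergodic_of_dense_iUnion_preimage_zero _ ?_ ?_ ?_
  · intro z
    choose y hy using fun i => QuotientAddGroup.mk_surjective (z i)
    let w : ℕ → Fin n → ℝ := fun k i => round ((2 : ℝ) ^ k * y i) / 2 ^ k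
    have hw : Tendsto w atTop (nhds y) := by
      refine tendsto_pi_nhds.2 fun i => ?_
      rw [tendsto_iff_dist_tendsto_zero]
      refine squeeze_zero (fun _ => dist_nonneg) (g := fun k => (1 / 2 : ℝ) ^ k) (fun k => ?_)
        (tendsto_pow_atTop_nhds_zero_of_lt_one (by norm_num) (by norm_num))
      have h2 : (0 : ℝ) < 2 ^ k := by positivity
      have h1 := abs_sub_round ((2 : ℝ) ^ k * y i)
      rw [Real.dist_eq, abs_sub_comm, show y i - w k i = ((2 : ℝ) ^ k * y i -
        round ((2 : ℝ) ^ k * y i)) / 2 ^ k by simp only [w]; field_simp, abs_div, abs_of_pos h2,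
        div_pow, one_pow]
      gcongr
      linarith
    have hcont : Continuous (toTorus (n := n)) :=
      continuous_pi fun i => (AddCircle.continuous_mk' (1 : ℝ)).comp (continuous_apply i)
    have hz : toTorus y = z := funext hy
    rw [← hz]
    refine mem_closure_of_tendsto ((hcont.tendsto y).comp hw) (Eventually.of_forall fun k => ?_)
    refine Set.mem_iUnion.2 ⟨k, ?_⟩
    have hit : ∀ v : Fin n → UnitAddCircle,
        (nsmulAddMonoidHom 2 : (Fin n → UnitAddCircle) →+ _)^[k] v = 2 ^ k • v := by
      intro v
      clear hw
      induction k with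
      | zero => simp
      | succ k ih =>
        rw [Function.iterate_succ_apply', ih, nsmulAddMonoidHom_apply, smul_smul, pow_succ']
    rw [Set.mem_preimage, hit, Function.comp_apply]
    change (2 ^ k) • toTorus (w k) = 0
    rw [← toTorus_nsmul]
    funext i
    have h3 : (((2 ^ k : ℕ) : ℝ) • w k) i = (round ((2 : ℝ) ^ k * y i) : ℝ) := by
      simp only [w, Pi.smul_apply, smul_eq_mul]
      push_cast
      field_simp
    rw [toTorus, h3]
    exact (AddCircle.coe_eq_zero_iff 1).2 ⟨round ((2 : ℝ) ^ k * y i), by simp⟩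
  · change Continuous fun z : Fin n → UnitAddCircle => 2 • z
    fun_prop
  · intro z
    choose y hy using fun i => QuotientAddGroup.mk_surjective (z i)
    refine ⟨toTorus ((1 / 2 : ℝ) • y), ?_⟩
    change 2 • toTorus ((1 / 2 : ℝ) • y) = z
    rw [← toTorus_nsmul, smul_smul]
    norm_num
    exact funext hy

/-- Points of the torus whose multiples `q z` are infinitely often within a fixed multiple of
`r q` from zero. -/
def torusApproximable (n : ℕ) (r : ℕ → ℝ) : Set (Fin n → UnitAddCircle) :=
  {z | ∃ c : ℕ, ∃ᶠ q in atTop, ‖q • z‖ < c * r q}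

lemma measurableSet_torusApproximable (r : ℕ → ℝ) : MeasurableSet (torusApproximable n r) := by
  have : torusApproximable n r =
      ⋃ c : ℕ, limsup (fun q => {z : Fin n → UnitAddCircle | ‖q • z‖ < c * r q}) atTop := by
    ext z
    simp only [torusApproximable, Set.mem_iUnion, mem_limsup_iff_frequently_mem]
    rfl
  rw [this]
  refine MeasurableSet.iUnion fun c => MeasurableSet.measurableSet_limsup fun q => ?_
  exact (isOpen_lt (by fun_prop) continuous_const).measurableSet

/-- A zero-one law. -/
lemma torusApproximable_ae_empty_or_univ (r : ℕ → ℝ) :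
    torusApproximable n r =ᵐ[volume] (∅ : Set _) ∨
      torusApproximable n r =ᵐ[volume] Set.univ := by
  refine ergodic_two_nsmul_torus.ae_empty_or_univ_of_ae_le_preimage
    (measurableSet_torusApproximable r).nullMeasurableSet (LE.le.eventuallyLE ?_)
  rintro z ⟨c, hc⟩
  -- Doubling `z` at most doubles `‖q • z‖`; the free constant `c` in `torusApproximable` absorbs
  -- this.
  refine ⟨2 * c, hc.mono fun q hq => ?_⟩
  have h1 : q • nsmulAddMonoidHom 2 z = 2 • q • z := by
    rw [nsmulAddMonoidHom_apply, smul_comm]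
  have h2 : ‖2 • q • z‖ ≤ 2 * ‖q • z‖ := by
    simpa using norm_nsmul_le (n := 2) (a := q • z)
  rw [h1]
  push_cast
  linarith

end Torus

/-! ### Gallagher's theorem. -/

lemma mem_blimsup_iff_frequently_mem {α : Type*} {s : ℕ → Set α} {p : ℕ → Prop} {a : α} :
    a ∈ blimsup s atTop p ↔ ∃ᶠ i in atTop, p i ∧ a ∈ s i := by
  rw [blimsup_eq_limsup, mem_limsup_iff_frequently_mem, frequently_inf_principal]
  rfl

/-- Gallagher's theorem: in dimension at least two, the divergence part of Khintchine's theorem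
holds without any monotonicity assumption. -/
theorem ae_frequently_norm_sub_lt {n : ℕ} (hn : 2 ≤ n) {r : ℕ → ℝ} (h0 : r 0 = 0)
    (hr : ∀ q, 0 ≤ r q) (hr' : ∀ q, r q ≤ 1 / 2) (hdiv : ¬ Summable fun q => r q ^ n) :
    ∀ᵐ y : Fin n → ℝ, ∃ᶠ q : ℕ in atTop, 0 < r q ∧
      ∃ p : Fin n → ℤ, ‖(q : ℝ) • y - fun i => (p i : ℝ)‖ < r q := by
  have hpos := volume_limsup_reducedBalls_pos hn h0 hr hr' hdiv
  have hscale : ∀ (q : ℕ), 0 < q → ∀ (y : Fin n → ℝ) (p : Fin n → ℤ),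
      ‖(q : ℝ) • y - fun i => (p i : ℝ)‖ = q * dist y (fun i => (p i : ℝ) / q) := by
    intro q hq y p
    have hq' : (0 : ℝ) < q := by exact_mod_cast hq
    have : (q : ℝ) • y - (fun i => (p i : ℝ)) = (q : ℝ) • (y - fun i => (p i : ℝ) / q) := by
      funext i
      simp only [Pi.sub_apply, Pi.smul_apply, smul_eq_mul]
      field_simp
    rw [this, norm_smul, Real.norm_of_nonneg hq'.le, dist_eq_norm]
  have hqpos : ∀ q, 0 < r q → 0 < q := fun q hq =>
    Nat.pos_of_ne_zero fun h => by rw [h, h0] at hq; exact hq.false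
  have hfull : ∀ᵐ z : Fin n → UnitAddCircle, z ∈ torusApproximable n r := by
    rcases torusApproximable_ae_empty_or_univ (n := n) r with h | h
    · exfalso
      have h1 : ∀ᵐ z : Fin n → UnitAddCircle, z ∉ torusApproximable n r :=
        measure_eq_zero_iff_ae_notMem.1 (ae_eq_empty.1 h)
      have h2 := ae_toTorus h1
      rw [ae_iff] at h2
      refine hpos.ne' (measure_mono_null (fun y hy => ?_) h2)
      rw [mem_limsup_iff_frequently_mem] at hy
      simp only [not_not, Set.mem_ofPred_eq]
      refine ⟨1, hy.mono fun q hq => ?_⟩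
      simp only [reducedBalls, Set.mem_iUnion] at hq
      obtain ⟨p, -, hyp⟩ := hq
      have hrq : 0 < r q := by
        by_contra! hcon
        have : r q / q ≤ 0 := div_nonpos_of_nonpos_of_nonneg hcon (Nat.cast_nonneg _)
        rw [Metric.ball_eq_empty.2 this] at hyp
        exact hyp
      have hq0 := hqpos q hrq
      rw [← toTorus_nsmul, Nat.cast_one, one_mul, norm_toTorus_lt_iff hrq]
      refine ⟨fun i => p i, ?_⟩
      rw [hscale q hq0, ← lt_div_iff₀' (by exact_mod_cast hq0)]
      simpa using hyp
    · exact ae_eq_univ.1 h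
  set S : ℕ → Set (Fin n → ℝ) := fun q => Set.range fun p : Fin n → ℤ => fun i => (p i : ℝ) / q
  -- Half of the target radius, so that the closed thickening of radius `ρ q` lies in the open one
  -- of radius `r q / q`.
  set ρ : ℕ → ℝ := fun q => r q / (2 * q)
  have hρ : Tendsto ρ atTop (nhds 0) := by
    refine squeeze_zero (fun q => by have := hr q; positivity) (g := fun q : ℕ => 1 / (q : ℝ))
      (fun q => ?_) tendsto_one_div_atTop_nhds_zero_nat
    rcases Nat.eq_zero_or_pos q with rfl | hq
    · simp [ρ]
    · have : (0 : ℝ) < q := by exact_mod_cast hq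
      rw [div_le_div_iff₀ (by positivity) this]
      nlinarith [hr' q]
  have hthick : ∀ᵐ y : Fin n → ℝ, ∀ c : ℕ,
      y ∈ blimsup (fun q => Metric.cthickening (2 * (c + 1) * ρ q) (S q)) atTop (fun q => 0 < r q) →
      y ∈ blimsup (fun q => Metric.cthickening (ρ q) (S q)) atTop (fun q => 0 < r q) := by
    rw [ae_all_iff]
    intro c
    -- Cassels' lemma: a constant factor in the radii changes the limsup only by a null set. The
    -- multiplier uses `c + 1` so as to be positive also for `c = 0`.
    exact (blimsup_cthickening_mul_ae_eq volume (fun q => 0 < r q) S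
      (show (0 : ℝ) < 2 * (c + 1) by positivity) ρ hρ).le
  filter_upwards [ae_toTorus hfull, hthick] with y ⟨c, hc⟩ hy
  have hmem := hy c (by
    rw [mem_blimsup_iff_frequently_mem]
    refine hc.mono fun q hq => ?_
    have hcr : 0 < c * r q := (norm_nonneg _).trans_lt hq
    have hrq : 0 < r q := pos_of_mul_pos_right hcr (Nat.cast_nonneg c)
    have hq0 := hqpos q hrq
    have hq' : (0 : ℝ) < q := by exact_mod_cast hq0
    refine ⟨hrq, ?_⟩
    rw [← toTorus_nsmul, norm_toTorus_lt_iff hcr] at hq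
    obtain ⟨p, hp⟩ := hq
    rw [hscale q hq0] at hp
    refine Metric.mem_cthickening_of_dist_le y _ _ _ ⟨p, rfl⟩ ?_
    have : 2 * (c + 1) * ρ q = (c + 1) * r q / q := by simp only [ρ]; field_simp
    rw [this, le_div_iff₀' hq']
    linarith)
  rw [mem_blimsup_iff_frequently_mem] at hmem
  refine hmem.mono fun q ⟨hrq, hyq⟩ => ⟨hrq, ?_⟩
  have hq0 := hqpos q hrq
  have hq' : (0 : ℝ) < q := by exact_mod_cast hq0
  have hlt : ρ q < r q / q := by
    simp only [ρ]
    rw [div_lt_div_iff₀ (by positivity) hq']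
    nlinarith [mul_pos hrq hq']
  have h1 := Metric.cthickening_subset_thickening' (by positivity) hlt (S q) hyq
  obtain ⟨_, ⟨p, rfl⟩, hp⟩ := Metric.mem_thickening_iff.1 h1
  refine ⟨p, ?_⟩
  rw [hscale q hq0, ← lt_div_iff₀' hq']
  exact hp

/-! ### Denominators that approximate the fixed coordinate. -/

/-- Pigeonhole: among the first `N` multiples of `x`, at least about `N δ` are within `δ` of an
integer. -/
lemma le_card_filter_abs_sub_lt (x : ℝ) (N : ℕ) {δ : ℝ} (hδ : 0 < δ) (hδ' : δ ≤ 1)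
    (P : ℕ → Prop) [DecidablePred P] (hP : ∀ q : ℕ, (∃ p : ℤ, |(q : ℝ) * x - p| < δ) → P q) :
    (N : ℝ) * δ / 2 - 1 ≤ ((Finset.Icc 1 N).filter P).card := by
  set M := ⌈1 / δ⌉₊ with hM
  have hM0 : 0 < M := Nat.ceil_pos.2 (by positivity)
  have hM0' : (0 : ℝ) < M := by exact_mod_cast hM0
  have hM1 : 1 / δ ≤ M := Nat.le_ceil _
  have hM2 : (M : ℝ) * δ ≤ 2 := by
    have := (Nat.ceil_lt_add_one (show 0 ≤ 1 / δ by positivity)).le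
    calc (M : ℝ) * δ ≤ (1 / δ + 1) * δ := by gcongr
      _ = 1 + δ := by field_simp
      _ ≤ 2 := by linarith
  -- The boxes have length `1 / M ≤ δ`. In a box holding at least `(N + 1) / M` of the indices `0,
  -- …, N`, subtracting the least index `m` from the others gives distinct positive integers, at the
  -- cost of one element.
  set f : ℕ → ℕ := fun q => ⌊Int.fract ((q : ℝ) * x) * M⌋₊
  have hf : ∀ q ∈ Finset.range (N + 1), f q ∈ Finset.range M := fun q _ => by
    rw [Finset.mem_range, Nat.floor_lt (by have := Int.fract_nonneg ((q : ℝ) * x); positivity)]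
    nlinarith [Int.fract_lt_one ((q : ℝ) * x)]
  obtain ⟨b, -, hb⟩ := Finset.exists_le_card_fiber_of_nsmul_le_card_of_maps_to
    (b := ((N : ℝ) + 1) / M) hf ⟨0, Finset.mem_range.2 hM0⟩ (by
      rw [Finset.card_range, Finset.card_range, nsmul_eq_mul]
      push_cast
      rw [mul_div_cancel₀ _ hM0'.ne'])
  set F := (Finset.range (N + 1)).filter fun q => f q = b
  have hFne : F.Nonempty := by
    rw [← Finset.card_pos]
    have : (0 : ℝ) < F.card := lt_of_lt_of_le (by positivity) hb
    exact_mod_cast this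
  set m := F.min' hFne
  have hm : m ∈ F := F.min'_mem hFne
  have hle : (F.erase m).card ≤ ((Finset.Icc 1 N).filter P).card := by
    refine Finset.card_le_card_of_injOn (· - m) ?_ ?_
    · intro q hq
      obtain ⟨hqm, hqF⟩ := Finset.mem_erase.1 (Finset.mem_coe.1 hq)
      have hmq : m ≤ q := F.min'_le q hqF
      have hqN := Finset.mem_range.1 (Finset.mem_filter.1 hqF).1
      have hfq : f q = f m := (Finset.mem_filter.1 hqF).2.trans (Finset.mem_filter.1 hm).2.symm
      simp only [Finset.coe_filter, Finset.mem_Icc, Set.mem_ofPred_eq]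
      refine ⟨by omega, hP _ ⟨⌊(q : ℝ) * x⌋ - ⌊(m : ℝ) * x⌋, ?_⟩⟩
      have h1 : |Int.fract ((q : ℝ) * x) * M - Int.fract ((m : ℝ) * x) * M| < 1 := by
        have hq1 := Nat.floor_le (a := Int.fract ((q : ℝ) * x) * M)
          (by have := Int.fract_nonneg ((q : ℝ) * x); positivity)
        have hq2 := Nat.lt_floor_add_one (Int.fract ((q : ℝ) * x) * M)
        have hm1 := Nat.floor_le (a := Int.fract ((m : ℝ) * x) * M)
          (by have := Int.fract_nonneg ((m : ℝ) * x); positivity)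
        have hm2 := Nat.lt_floor_add_one (Int.fract ((m : ℝ) * x) * M)
        have hfq' : (⌊Int.fract ((q : ℝ) * x) * M⌋₊ : ℝ) = ⌊Int.fract ((m : ℝ) * x) * M⌋₊ := by
          exact_mod_cast hfq
        rw [abs_lt]
        constructor <;> linarith
      rw [← sub_mul, abs_mul, abs_of_pos hM0', ← lt_div_iff₀ hM0'] at h1
      have h2 : ((q - m : ℕ) : ℝ) * x - ((⌊(q : ℝ) * x⌋ - ⌊(m : ℝ) * x⌋ : ℤ) : ℝ) =
          Int.fract ((q : ℝ) * x) - Int.fract ((m : ℝ) * x) := by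
        rw [Nat.cast_sub hmq, ← Int.self_sub_floor, ← Int.self_sub_floor]
        push_cast
        ring
      rw [h2]
      refine h1.trans_le ?_
      rw [div_le_iff₀ hM0']
      rwa [div_le_iff₀' hδ] at hM1
    · intro q hq q' hq' h
      have h1 : m ≤ q := F.min'_le q (Finset.mem_of_mem_erase (Finset.mem_coe.1 hq))
      have h2 : m ≤ q' := F.min'_le q' (Finset.mem_of_mem_erase (Finset.mem_coe.1 hq'))
      simp only at h
      omega
  have hcard : (F.card : ℝ) - 1 ≤ ((Finset.Icc 1 N).filter P).card := by
    have h1 := Finset.card_erase_add_one hm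
    have : F.card ≤ ((Finset.Icc 1 N).filter P).card + 1 := by omega
    have : (F.card : ℝ) ≤ ((Finset.Icc 1 N).filter P).card + 1 := by exact_mod_cast this
    linarith
  have h3 : (N : ℝ) * δ / 2 ≤ (N + 1) / M := by
    rw [div_le_div_iff₀ two_pos hM0']
    have : (0 : ℝ) ≤ N := Nat.cast_nonneg N
    nlinarith
  linarith

/-- Comparison with the telescoping differences of `1 / √q`. With `u = √q` and `v = √(q + 1) ≤ 2 u`,
one has `1 / u - 1 / v = 1 / (u v (u + v)) ≥ 1 / (6 u^3)`. -/
lemma sum_Ico_inv_mul_sqrt_le {a : ℕ} (ha : 1 ≤ a) (N : ℕ) :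
    ∑ q ∈ Finset.Ico a N, √a / (q * √q) ≤ 6 := by
  have hsa : 0 < √(a : ℝ) := Real.sqrt_pos.2 (by exact_mod_cast ha)
  have key : ∀ q ∈ Finset.Ico a N, √a / (q * √q) ≤
      6 * √a * (1 / √(q : ℝ) - 1 / √((q + 1 : ℕ) : ℝ)) := by
    intro q hq
    have hq1 : (1 : ℝ) ≤ q := by exact_mod_cast ha.trans (Finset.mem_Ico.1 hq).1
    have hu2 : √(q : ℝ) ^ 2 = q := Real.sq_sqrt (by linarith)
    have hv2 : √((q + 1 : ℕ) : ℝ) ^ 2 = q + 1 := by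
      rw [Real.sq_sqrt (by positivity)]; push_cast; ring
    set u := √(q : ℝ)
    set v := √((q + 1 : ℕ) : ℝ)
    have hu : 0 < u := Real.sqrt_pos.2 (by linarith)
    have hv : 0 < v := Real.sqrt_pos.2 (by positivity)
    have hv2u : v ≤ 2 * u := by
      refine le_of_pow_le_pow_left₀ two_ne_zero (by positivity) ?_
      nlinarith
    have hvu : (v - u) * (v + u) = 1 := by nlinarith
    have h1 : 1 / (q * u) ≤ 6 * (1 / u - 1 / v) := by
      rw [← hu2, div_sub_div _ _ hu.ne' hv.ne', ← mul_div_assoc,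
        div_le_div_iff₀ (by positivity) (by positivity)]
      have h2 : v * (v + u) ≤ 6 * u ^ 2 * ((v - u) * (v + u)) := by rw [hvu]; nlinarith
      have h3 : v ≤ 6 * u ^ 2 * (v - u) := by
        refine le_of_mul_le_mul_right ?_ (show 0 < v + u by positivity)
        linarith
      nlinarith
    calc √a / (q * u) = √a * (1 / (q * u)) := by ring
      _ ≤ √a * (6 * (1 / u - 1 / v)) := by gcongr
      _ = _ := by ring
  rcases le_or_gt N a with h | h
  · rw [Finset.Ico_eq_empty (by omega)]; norm_num
  refine (Finset.sum_le_sum key).trans ?_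
  rw [← Finset.mul_sum, Finset.sum_Ico_eq_sub _ h.le,
    Finset.sum_range_sub' (fun q : ℕ => 1 / √(q : ℝ)), Finset.sum_range_sub' (fun q : ℕ => 1 / √(q : ℝ))]
  have : 0 ≤ 1 / √(N : ℝ) := by positivity
  have h2 : 6 * √(a : ℝ) * (1 / √(a : ℝ)) = 6 := by field_simp
  nlinarith

open Classical in
/-- The function `ψ` restricted to those `q ≥ q₀` for which `q x` is within `ψ q` of an integer. -/
noncomputable def fiberFun (x : ℝ) (ψ : ℕ → ℝ) (q₀ q : ℕ) : ℝ :=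
  if q₀ ≤ q ∧ ∃ p : ℤ, |(q : ℝ) * x - p| < ψ q then ψ q else 0

/-- The hypothesis `hanti'` supplies the factor `√(a / q)` when `ψ q ^ n` is replaced by `ψ a ^ n`.
Monotonicity alone would leave the divergent sum of `1 / q` after the interchange. -/
lemma not_summable_fiberFun_pow (x : ℝ) {n : ℕ} (hn : n ≠ 0) {ψ : ℕ → ℝ} {q₀ : ℕ} (hq₀ : 1 ≤ q₀)
    (hpos : ∀ q, q₀ ≤ q → 0 < ψ q) (hle : ∀ q, q₀ ≤ q → ψ q ≤ 1)
    (hanti : ∀ a q, q₀ ≤ a → a ≤ q → ψ q ≤ ψ a)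
    (hanti' : ∀ a q, q₀ ≤ a → a ≤ q → ψ q ^ n * √q ≤ ψ a ^ n * √a)
    (htend : Tendsto (fun q : ℕ => q * ψ q) atTop atTop)
    (hdiv : ¬ Summable fun q => ψ q ^ (n + 1)) :
    ¬ Summable fun q => fiberFun x ψ q₀ q ^ n := by
  classical
  intro hsum
  set A : ℕ → Prop := fun q => q₀ ≤ q ∧ ∃ p : ℤ, |(q : ℝ) * x - p| < ψ q
  have hfib : ∀ q, fiberFun x ψ q₀ q ^ n = if A q then ψ q ^ n else 0 := fun q => by
    simp only [fiberFun, A]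
    split_ifs
    · rfl
    · simp [hn]
  have hfib0 : ∀ q, 0 ≤ fiberFun x ψ q₀ q ^ n := fun q => by
    rw [hfib]
    split_ifs with h
    · exact pow_nonneg (hpos q h.1).le _
    · rfl
  -- From here on `q ψ(q) / 4` absorbs the loss `1` of the pigeonhole count and the at most `q₀`
  -- indices below `q₀`.
  obtain ⟨N₁, hN₁⟩ := eventually_atTop.1 (htend.eventually_ge_atTop (4 * (q₀ + 1)))
  set N₂ := max N₁ q₀
  have hcount : ∀ q, N₂ ≤ q → q * ψ q / 4 ≤ ∑ a ∈ Finset.Icc q₀ q, if A a then (1 : ℝ) else 0 := by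
    intro q hq
    have hqq₀ : q₀ ≤ q := (le_max_right _ _).trans hq
    have h1 := le_card_filter_abs_sub_lt x q (hpos q hqq₀) (hle q hqq₀)
      (fun a => ∃ p : ℤ, |(a : ℝ) * x - p| < ψ q) (fun _ h => h)
    have h2 : (Finset.Icc 1 q).filter (fun a : ℕ => ∃ p : ℤ, |(a : ℝ) * x - p| < ψ q) ⊆
        Finset.range q₀ ∪ (Finset.Icc q₀ q).filter A := by
      intro a ha
      simp only [Finset.mem_filter, Finset.mem_Icc] at ha
      obtain ⟨⟨_, haq⟩, p, hp⟩ := ha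
      simp only [Finset.mem_union, Finset.mem_range, Finset.mem_filter, Finset.mem_Icc]
      rcases lt_or_ge a q₀ with h | h
      · exact Or.inl h
      -- The count is made with the threshold `ψ q`, which is at most `ψ a`, so these `a` satisfy
      -- `A`.
      · exact Or.inr ⟨⟨h, haq⟩, h, p, hp.trans_le (hanti a q h haq)⟩
    have h3 := (Finset.card_le_card h2).trans (Finset.card_union_le _ _)
    rw [Finset.card_range] at h3
    have h4 : (((Finset.Icc 1 q).filter
        (fun a : ℕ => ∃ p : ℤ, |(a : ℝ) * x - p| < ψ q)).card : ℝ) ≤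
        q₀ + ((Finset.Icc q₀ q).filter A).card := by exact_mod_cast h3
    rw [Finset.sum_boole]
    have h5 := hN₁ q ((le_max_left _ _).trans hq)
    linarith
  have hbound : ∀ N, ∑ q ∈ Finset.Ico N₂ N, ψ q ^ (n + 1) ≤
      24 * ∑' q, fiberFun x ψ q₀ q ^ n := by
    intro N
    have hterm : ∀ q ∈ Finset.Ico N₂ N, ψ q ^ (n + 1) ≤
        ∑ a ∈ Finset.Icc q₀ q, 4 * (fiberFun x ψ q₀ a ^ n * (√a / (q * √q))) := by
      intro q hq
      have hqN := (Finset.mem_Ico.1 hq).1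
      have hqq₀ : q₀ ≤ q := (le_max_right _ _).trans hqN
      have hq0 : (0 : ℝ) < q := by exact_mod_cast hq₀.trans hqq₀
      have hsq : 0 < √(q : ℝ) := Real.sqrt_pos.2 hq0
      have hψ := hpos q hqq₀
      calc ψ q ^ (n + 1) = 4 * ψ q ^ n / q * (q * ψ q / 4) := by
            rw [pow_succ]; field_simp
        _ ≤ 4 * ψ q ^ n / q * ∑ a ∈ Finset.Icc q₀ q, (if A a then (1 : ℝ) else 0) := by
            gcongr; exact hcount q hqN
        _ ≤ _ := by
            rw [Finset.mul_sum]
            refine Finset.sum_le_sum fun a ha => ?_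
            obtain ⟨ha1, ha2⟩ := Finset.mem_Icc.1 ha
            rw [hfib]
            split_ifs with h
            · have := hanti' a q ha1 ha2
              calc 4 * ψ q ^ n / q * 1 = 4 * ((ψ q ^ n * √q) / (q * √q)) := by field_simp
                _ ≤ 4 * ((ψ a ^ n * √a) / (q * √q)) := by gcongr
                _ = _ := by ring
            · simp
    calc _ ≤ ∑ q ∈ Finset.Ico N₂ N,
          ∑ a ∈ Finset.Icc q₀ q, 4 * (fiberFun x ψ q₀ a ^ n * (√a / (q * √q))) :=
          Finset.sum_le_sum hterm
      _ ≤ ∑ q ∈ Finset.Ico q₀ N,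
          ∑ a ∈ Finset.Icc q₀ q, 4 * (fiberFun x ψ q₀ a ^ n * (√a / (q * √q))) := by
          refine Finset.sum_le_sum_of_subset_of_nonneg
            (Finset.Ico_subset_Ico_left (le_max_right _ _)) fun q _ _ => ?_
          refine Finset.sum_nonneg fun a _ => ?_
          have := hfib0 a
          positivity
      _ = ∑ a ∈ Finset.Ico q₀ N,
          ∑ q ∈ Finset.Ico a N, 4 * (fiberFun x ψ q₀ a ^ n * (√a / (q * √q))) := by
          refine Finset.sum_comm' fun q a => ?_
          simp only [Finset.mem_Ico, Finset.mem_Icc]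
          omega
      _ ≤ ∑ a ∈ Finset.Ico q₀ N, 24 * fiberFun x ψ q₀ a ^ n := by
          refine Finset.sum_le_sum fun a ha => ?_
          rw [← Finset.mul_sum, ← Finset.mul_sum]
          have := sum_Ico_inv_mul_sqrt_le (hq₀.trans (Finset.mem_Ico.1 ha).1) N
          nlinarith [hfib0 a]
      _ ≤ _ := by
          rw [← Finset.mul_sum]
          gcongr
          exact hsum.sum_le_tsum _ fun a _ => hfib0 a
  refine hdiv ((summable_nat_add_iff N₂).1 ?_)
  refine summable_of_sum_range_le (c := 24 * ∑' q, fiberFun x ψ q₀ q ^ n)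
    (fun q => pow_nonneg (hpos _ ((le_max_right _ _).trans (Nat.le_add_left _ _))).le _)
    fun N => ?_
  have := hbound (N₂ + N)
  rw [Finset.sum_Ico_eq_sum_range, Nat.add_sub_cancel_left] at this
  simpa only [add_comm] using this

/-- Almost every point of a fibre over `x` is `ψ`-approximable, for `ψ` decreasing at a suitable
rate with `∑ ψ ^ (n + 1)` divergent. -/
theorem ae_cons_mem_approximable (x : ℝ) {n : ℕ} (hn : 2 ≤ n) {ψ : ℕ → ℝ} {q₀ : ℕ} (hq₀ : 1 ≤ q₀)
    (hpos : ∀ q, q₀ ≤ q → 0 < ψ q) (hle : ∀ q, q₀ ≤ q → ψ q ≤ 1 / 2)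
    (hanti : ∀ a q, q₀ ≤ a → a ≤ q → ψ q ≤ ψ a)
    (hanti' : ∀ a q, q₀ ≤ a → a ≤ q → ψ q ^ n * √q ≤ ψ a ^ n * √a)
    (htend : Tendsto (fun q : ℕ => q * ψ q) atTop atTop)
    (hdiv : ¬ Summable fun q => ψ q ^ (n + 1)) :
    ∀ᵐ y : Fin n → ℝ, (Fin.cons x y : Fin (n + 1) → ℝ) ∈ approximable (n + 1) ψ := by
  have h := not_summable_fiberFun_pow x (show n ≠ 0 by omega) hq₀ hpos
    (fun q hq => (hle q hq).trans (by norm_num)) hanti hanti' htend hdiv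
  have hcase : ∀ q, 0 ≤ fiberFun x ψ q₀ q ∧ fiberFun x ψ q₀ q ≤ 1 / 2 := fun q => by
    unfold fiberFun
    split_ifs with hq
    · exact ⟨(hpos q hq.1).le, hle q hq.1⟩
    · norm_num
  have h0 : fiberFun x ψ q₀ 0 = 0 := if_neg fun h => by omega
  filter_upwards [ae_frequently_norm_sub_lt hn h0 (fun q => (hcase q).1) (fun q => (hcase q).2) h]
    with y hy
  refine Set.Infinite.of_image Prod.snd
    ((Nat.frequently_atTop_iff_infinite.1 hy).mono ?_)
  rintro q ⟨hq, p, hp⟩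
  have hqA : q₀ ≤ q ∧ ∃ p : ℤ, |(q : ℝ) * x - p| < ψ q := by
    by_contra hcon
    rw [fiberFun, if_neg hcon] at hq
    exact hq.false
  rw [fiberFun, if_pos hqA] at hp
  obtain ⟨hqq₀, p₀, hp₀⟩ := hqA
  have hψ := hpos q hqq₀
  refine ⟨(Fin.cons p₀ p, q), ⟨hq₀.trans hqq₀, (pi_norm_lt_iff hψ).2 fun i => ?_⟩, rfl⟩
  refine Fin.cases ?_ (fun j => ?_) i
  · simpa using hp₀
  · simpa using (pi_norm_lt_iff hψ).1 hp j

/-! ### Iterated logarithms and the properties of `psi`. -/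

lemma iterLog_zero (t : ℝ) : iterLog 0 t = t := rfl

lemma iterLog_succ (i : ℕ) (t : ℝ) : iterLog (i + 1) t = Real.log (iterLog i t) :=
  Function.iterate_succ_apply' _ _ _

lemma tendsto_iterLog (i : ℕ) : Tendsto (iterLog i) atTop atTop := by
  induction i with
  | zero => exact tendsto_id
  | succ i ih =>
    have := Real.tendsto_log_atTop.comp ih
    exact this.congr fun t => (iterLog_succ i t).symm

lemma exists_one_le_iterLog (s : ℕ) : ∃ t₀ : ℝ, ∀ t, t₀ ≤ t → ∀ i ≤ s, 1 ≤ iterLog i t := by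
  have h : ∀ᶠ t in atTop, ∀ i ∈ Finset.range (s + 1), 1 ≤ iterLog i t :=
    (Filter.eventually_all_finset _).2 fun i _ => (tendsto_iterLog i).eventually_ge_atTop 1
  obtain ⟨t₀, ht₀⟩ := eventually_atTop.1 h
  exact ⟨t₀, fun t ht i hi => ht₀ t ht i (Finset.mem_range.2 (by omega))⟩

section

variable {s : ℕ} {t₀ : ℝ}

lemma iterLog_mono (h : ∀ t, t₀ ≤ t → ∀ i ≤ s, 1 ≤ iterLog i t) {i : ℕ} (hi : i ≤ s) {t t' : ℝ}
    (ht : t₀ ≤ t) (htt : t ≤ t') : iterLog i t ≤ iterLog i t' := by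
  induction i with
  | zero => exact htt
  | succ i ih =>
    rw [iterLog_succ, iterLog_succ]
    exact Real.log_le_log (by linarith [h t ht i (by omega)]) (ih (by omega))

lemma iterLog_succ_le_log (h : ∀ t, t₀ ≤ t → ∀ i ≤ s, 1 ≤ iterLog i t) {i : ℕ} (hi : i + 1 ≤ s)
    {t : ℝ} (ht : t₀ ≤ t) : iterLog (i + 1) t ≤ Real.log t := by
  induction i with
  | zero => rw [iterLog_succ, iterLog_zero]
  | succ i ih =>
    rw [iterLog_succ]
    exact (Real.log_le_self (by linarith [h t ht (i + 1) (by omega)])).trans (ih (by omega))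

/-- A discrete form of the derivative of `log^{(i)}`, obtained by iterating `log u ≤ u - 1`. -/
lemma iterLog_add_one_sub_le (h : ∀ t, t₀ ≤ t → ∀ i ≤ s, 1 ≤ iterLog i t) {i : ℕ}
    (hi : i ≤ s + 1) {t : ℝ} (ht : t₀ ≤ t) :
    iterLog i (t + 1) - iterLog i t ≤ 1 / ∏ j ∈ Finset.range i, iterLog j t := by
  induction i with
  | zero => simp [iterLog_zero]
  | succ i ih =>
    have ha := h t ht i (by omega)
    have hb := h (t + 1) (by linarith) i (by omega)
    rw [iterLog_succ, iterLog_succ, Finset.prod_range_succ, ← Real.log_div (by linarith) (by linarith)]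
    calc _ ≤ iterLog i (t + 1) / iterLog i t - 1 := Real.log_le_sub_one_of_pos (by positivity)
      _ = (iterLog i (t + 1) - iterLog i t) / iterLog i t := by
          field_simp
      _ ≤ (1 / ∏ j ∈ Finset.range i, iterLog j t) / iterLog i t := by
          gcongr; exact ih (by omega)
      _ = _ := by rw [div_div]

end

/-- The product `q · log q ⋯ log^{(s)} q`. -/
noncomputable def logProd (s : ℕ) (t : ℝ) : ℝ := ∏ i ∈ Finset.range (s + 1), iterLog i t

lemma logProd_eq (s : ℕ) (t : ℝ) :
    logProd s t = t * ∏ i ∈ Finset.range s, iterLog (i + 1) t := by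
  rw [logProd, Finset.prod_range_succ', iterLog_zero, mul_comm]

lemma psi_pow (s d : ℕ) (hd : d ≠ 0) (q : ℕ) (h : 0 ≤ logProd s q) :
    psi s d q ^ d = 1 / logProd s q := by
  change ((1 / logProd s q) ^ (1 / (d : ℝ))) ^ d = _
  rw [one_div (d : ℝ), Real.rpow_inv_natCast_pow (by positivity) hd]

/-- The terms eventually dominate the increments of `log^{(s+1)}`, which is unbounded. -/
lemma not_summable_one_div_logProd (s : ℕ) : ¬ Summable fun q : ℕ => 1 / logProd s q := by
  intro hsum
  obtain ⟨t₀, h⟩ := exists_one_le_iterLog s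
  set N := ⌈t₀⌉₊
  have hN : ∀ q : ℕ, t₀ ≤ ((q + N : ℕ) : ℝ) := fun q =>
    (Nat.le_ceil t₀).trans (by exact_mod_cast Nat.le_add_left _ _)
  have hsum' := (summable_nat_add_iff N).2 hsum
  have hbound : ∀ M : ℕ, iterLog (s + 1) ((M + N : ℕ) : ℝ) ≤
      iterLog (s + 1) ((0 + N : ℕ) : ℝ) + ∑' q : ℕ, 1 / logProd s ((q + N : ℕ) : ℝ) := by
    intro M
    have h1 := Finset.sum_range_sub (fun q : ℕ => iterLog (s + 1) ((q + N : ℕ) : ℝ)) M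
    have h2 : ∑ q ∈ Finset.range M, (iterLog (s + 1) ((q + 1 + N : ℕ) : ℝ) -
        iterLog (s + 1) ((q + N : ℕ) : ℝ)) ≤
        ∑ q ∈ Finset.range M, 1 / logProd s ((q + N : ℕ) : ℝ) := by
      refine Finset.sum_le_sum fun q _ => ?_
      have e : ((q + 1 + N : ℕ) : ℝ) = ((q + N : ℕ) : ℝ) + 1 := by push_cast; ring
      rw [e]
      exact iterLog_add_one_sub_le h le_rfl (hN q)
    have h3 := hsum'.sum_le_tsum (Finset.range M) fun q _ => by
      refine one_div_nonneg.2 (Finset.prod_nonneg fun i hi => ?_)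
      linarith [h _ (hN q) i (by have := Finset.mem_range.1 hi; omega)]
    linarith
  have ht : Tendsto (fun M : ℕ => iterLog (s + 1) ((M + N : ℕ) : ℝ)) atTop atTop :=
    (tendsto_iterLog (s + 1)).comp
      (tendsto_natCast_atTop_atTop.comp (tendsto_add_atTop_nat N))
  obtain ⟨M, hM⟩ := (ht.eventually_gt_atTop _).exists
  exact (hbound M).not_gt hM

/-- For every real `x`, rational or not and without any condition on its continued fraction, almost every point of the fibre over `x` is `psi s (n + 1)`-approximable. -/
theorem ae_cons_mem_approximable_psi (n : ℕ) (hn : 2 ≤ n) (s : ℕ) (x : ℝ) :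
    ∀ᵐ y : Fin n → ℝ, (Fin.cons x y : Fin (n + 1) → ℝ) ∈ approximable (n + 1) (psi s (n + 1)) := by
  obtain ⟨t₀, h⟩ := exists_one_le_iterLog s
  have hlog : ∀ᶠ t : ℝ in atTop, Real.log t ^ s ≤ t := by
    have h1 := (Real.isLittleO_pow_log_id_atTop (n := s)).bound one_pos
    filter_upwards [h1, eventually_ge_atTop 0] with t ht ht0
    rw [one_mul, id, Real.norm_of_nonneg ht0] at ht
    exact (le_abs_self _).trans ht
  set L : ℕ → ℝ := fun q => logProd s q
  set K : ℕ → ℝ := fun q => ∏ i ∈ Finset.range s, iterLog (i + 1) (q : ℝ)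
  have hLK : ∀ q, L q = q * K q := fun q => logProd_eq s q
  obtain ⟨N, hN⟩ := eventually_atTop.1
    ((tendsto_natCast_atTop_atTop (R := ℝ)).eventually (hlog.and (eventually_ge_atTop t₀)))
  -- The bound `2 ^ (n + 1)` makes `ψ(q)^(n+1) = 1 / L q ≤ 1 / q` at most `2^(-(n+1))`, that is,
  -- `ψ(q) ≤ 1 / 2`.
  set q₀ := max N (2 ^ (n + 1))
  have hq₀ : 1 ≤ q₀ := Nat.one_le_two_pow.trans (le_max_right _ _)
  have hqN : ∀ q, q₀ ≤ q → N ≤ q := fun q hq => (le_max_left _ _).trans hq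
  have hq1 : ∀ q : ℕ, q₀ ≤ q → (1 : ℝ) ≤ q := fun q hq => by exact_mod_cast hq₀.trans hq
  have hK1 : ∀ q, q₀ ≤ q → 1 ≤ K q := fun q hq => by
    refine Finset.prod_induction _ (fun t : ℝ => 1 ≤ t) (fun _ _ ha hb => one_le_mul_of_one_le_of_one_le ha hb) le_rfl
      fun i hi => h _ (hN q (hqN q hq)).2 _ (by have := Finset.mem_range.1 hi; omega)
  have hKmono : ∀ a q, q₀ ≤ a → a ≤ q → K a ≤ K q := fun a q ha haq => by
    refine Finset.prod_le_prod (fun i hi => ?_) fun i hi => ?_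
    · linarith [h _ (hN a (hqN a ha)).2 (i + 1) (by have := Finset.mem_range.1 hi; omega)]
    · exact iterLog_mono h (by have := Finset.mem_range.1 hi; omega) (hN a (hqN a ha)).2
        (by exact_mod_cast haq)
  have hKle : ∀ q, q₀ ≤ q → K q ≤ q := fun q hq => by
    refine le_trans ?_ (hN q (hqN q hq)).1
    have hc : Real.log (q : ℝ) ^ s = ∏ _i ∈ Finset.range s, Real.log (q : ℝ) := by simp
    rw [hc]
    refine Finset.prod_le_prod (fun i hi => ?_) fun i hi => ?_
    · linarith [h _ (hN q (hqN q hq)).2 (i + 1) (by have := Finset.mem_range.1 hi; omega)]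
    · exact iterLog_succ_le_log h (by have := Finset.mem_range.1 hi; omega) (hN q (hqN q hq)).2
  have hL0 : ∀ q, q₀ ≤ q → 0 < L q := fun q hq => by
    rw [hLK]
    have := hK1 q hq
    have := hq1 q hq
    positivity
  have hpsi : ∀ q, psi s (n + 1) q = (1 / L q) ^ (1 / ((n + 1 : ℕ) : ℝ)) := fun _ => rfl
  have hpow : ∀ q, q₀ ≤ q → psi s (n + 1) q ^ (n + 1) = 1 / L q := fun q hq =>
    psi_pow s (n + 1) (by omega) q (hL0 q hq).le
  have hpos : ∀ q, q₀ ≤ q → 0 < psi s (n + 1) q := fun q hq => by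
    have := hL0 q hq
    rw [hpsi]
    positivity
  have hratio : ∀ a q, q₀ ≤ a → a ≤ q →
      psi s (n + 1) q ^ (n + 1) * q ≤ psi s (n + 1) a ^ (n + 1) * a := fun a q ha haq => by
    have hq := ha.trans haq
    have h1 := hK1 a ha
    have h2 := hK1 q hq
    have h3 := hq1 a ha
    have h4 := hq1 q hq
    rw [hpow q hq, hpow a ha, hLK, hLK]
    calc 1 / ((q : ℝ) * K q) * q = 1 / K q := by field_simp
      _ ≤ 1 / K a := by gcongr; exact hKmono a q ha haq
      _ = _ := by field_simp
  have hanti : ∀ a q, q₀ ≤ a → a ≤ q → psi s (n + 1) q ≤ psi s (n + 1) a := fun a q ha haq => by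
    refine le_of_pow_le_pow_left₀ (show n + 1 ≠ 0 by omega) (hpos a ha).le ?_
    have h1 := hratio a q ha haq
    have h2 : (a : ℝ) ≤ q := by exact_mod_cast haq
    have h3 := hq1 a ha
    have h4 := pow_pos (hpos a ha) (n + 1)
    have h5 := hq1 q (ha.trans haq)
    refine le_of_mul_le_mul_right (h1.trans ?_) (show (0 : ℝ) < q by linarith)
    gcongr
  refine ae_cons_mem_approximable x hn hq₀ hpos (fun q hq => ?_) hanti (fun a q ha haq => ?_) ?_ ?_
  · refine le_of_pow_le_pow_left₀ (show n + 1 ≠ 0 by omega) (by norm_num) ?_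
    rw [hpow q hq, div_pow, one_pow]
    gcongr
    have h1 : (2 ^ (n + 1) : ℝ) ≤ q := by exact_mod_cast (le_max_right _ _).trans hq
    have h2 := hK1 q hq
    rw [hLK]
    nlinarith [hq1 q hq]
  · have hq := ha.trans haq
    have h3 := hq1 a ha
    have h4 := hq1 q hq
    have hψa := hpos a ha
    have hψq := hpos q hq
    have hr := hratio a q ha haq
    refine le_of_pow_le_pow_left₀ (show 2 ≠ 0 by omega) (by positivity) ?_
    rw [mul_pow, mul_pow, Real.sq_sqrt (by linarith), Real.sq_sqrt (by linarith)]
    -- After squaring, `ψ^(2n) q` is the product of `ψ^(n+1) q`, decreasing by `hratio`, and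
    -- `ψ^(n-1)`, nonincreasing by `hanti`.
    have hsplit : ∀ u : ℝ, (u ^ n) ^ 2 = u ^ (n + 1) * u ^ (n - 1) := fun u => by
      rw [← pow_mul, ← pow_add]
      congr 1
      omega
    rw [hsplit, hsplit, mul_right_comm, mul_right_comm (psi s (n + 1) a ^ (n + 1))]
    gcongr
    exact hanti a q ha haq
  · refine tendsto_atTop_mono' atTop ?_
      ((tendsto_rpow_atTop (show (0 : ℝ) < 1 / ((n + 1 : ℕ) : ℝ) by positivity)).comp
        (tendsto_natCast_atTop_atTop (R := ℝ)))
    filter_upwards [eventually_ge_atTop q₀] with q hq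
    have h4 := hq1 q hq
    have h5 := hpos q hq
    refine le_of_pow_le_pow_left₀ (show n + 1 ≠ 0 by omega) (by positivity) ?_
    rw [Function.comp_apply, mul_pow, hpow q hq, one_div ((n + 1 : ℕ) : ℝ),
      Real.rpow_inv_natCast_pow (by linarith) (by omega), mul_one_div, le_div_iff₀ (hL0 q hq), hLK]
    -- The claim is `q^(1/(n+1)) ≤ q ψ(q)`; raised to the power `n + 1` it reads `q L(q) ≤ q^(n+1)`,
    -- which follows from `K q ≤ q` and `3 ≤ n + 1`.
    calc (q : ℝ) * (q * K q) ≤ q * (q * q) := by gcongr; exact hKle q hq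
      _ = (q : ℝ) ^ 3 := by ring
      _ ≤ _ := pow_le_pow_right₀ h4 (by omega)
  · intro hsum
    refine not_summable_one_div_logProd s ((summable_nat_add_iff q₀).1 ?_)
    refine ((summable_nat_add_iff q₀).2 hsum).congr fun q => ?_
    exact hpow _ (Nat.le_add_left _ _)

end FiberApprox

theorem theorem30 (n : ℕ) (hn : 2 ≤ n) (s : ℕ) (hs : 1 ≤ s)
    (x : ℝ) (hx : Irrational x) (hxL : ¬ Liouville x) (R : ℝ) (hR : 0 ≤ R)
    (h : (∃ ε : ℝ, 0 < ε ∧ ∃ᶠ m : ℕ in atTop,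
            1 + ε ≤ FiberApprox.iterLog (s - 1) (FiberApprox.deltaK x R m : ℝ) /
              FiberApprox.iterLog (s - 1) (FiberApprox.kSeq x R m : ℝ)) ∨
         (1 < FiberApprox.essDiophantineType x ∧
            ∀ᶠ m : ℕ in atTop, FiberApprox.deltaK x R m ≤ FiberApprox.kSeq x R m)) :
    ∀ᵐ y : Fin n → ℝ,
      (Fin.cons x y : Fin (n + 1) → ℝ) ∈
        FiberApprox.approximable (n + 1) (FiberApprox.psi s (n + 1)) :=
  FiberApprox.ae_cons_mem_approximable_psi n hn s x
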